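/- Consider combinatorial auctions with a set $M$ of $m$ items and $n$ bidders, where bidder $i$ has a valuation $v_i : 2^M \to \mathbb{R}$. An allocation is a tuple $(S_1,\dots,S_n)$ of pairwise disjoint subsets of $M$, and its welfare is $\sum_i v_i(S_i)$. In a (possibly randomized) simultaneous algorithm every bidder sends, once and simultaneously, a bit string that depends only on his own valuation and on random coins (which may be shared by everybody), and the allocation is determined by the messages and the coins alone. For $\alpha \ge 1$ and a class $\mathcal{V}$ of valuations, the algorithm is an $\alpha$-approximation on $\mathcal{V}$ if for every profile $(v_1,\dots,v_n)\in\mathcal{V}^n$ the maximum welfare of an allocation is at most $\alpha$ times the expected welfare of the allocation that the algorithm outputs. Its communication on $\mathcal{V}$ is the supremum, over all profiles in $\mathcal{V}^n$ and all outcomes of the coins, of the total number of bits sent by all bidders. A valuation $v$ is a matroid rank valuation if it is the rank function of a matroid with ground set $M$. It is a gross substitutes valuation if $v(\emptyset)=0$, $v(S)\le v(T)$ whenever $S\subseteq T$, and for all price vectors $p\le p'$ in $\mathbb{R}^M$ and every bundle $S$ that maximizes $v(T)-\sum_{j\in T}p_j$ over $T\subseteq M$ there is a bundle $S'$ that maximizes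 $v(T)-\sum_{j\in T}p'_j$ over $T\subseteq M$ with $S\cap\{j : p_j=p'_j\}\subseteq S'$. **Theorem.** For all sufficiently large $m$ and all $n\ge m^{1/8}\left(m^{3/4}-m^{1/2}+1\right)$ the following holds. Let $\mathcal{V}$ be the class of matroid rank valuations, or the class of gross substitutes valuations, over $m$ items. Then every (possibly randomized) simultaneous algorithm for $n$ bidders that is an $m^{1/16}$-approximation on $\mathcal{V}$ has communication greater than $2^{m^{1/32}}$ on $\mathcal{V}$. -/

import Mathlib

open MeasureTheory

noncomputable section

namespace SimAuction

/-- A valuation of a bidder over the items `Fin m`: a real value for every bundle. -/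
abbrev Valuation (m : ℕ) : Type := Finset (Fin m) → ℝ

/-- `v` is the rank function of a matroid whose ground set is the set of all items. -/
def IsMatroidRank {m : ℕ} (v : Valuation m) : Prop :=
  ∃ M : Matroid (Fin m), M.E = Set.univ ∧
    ∀ S : Finset (Fin m), v S = ((M.eRk (S : Set (Fin m))).toNat : ℝ)

/-- The class of matroid rank valuations. -/
def matroidRankValuations (m : ℕ) : Set (Valuation m) := {v | IsMatroidRank v}

/-- The bundles that maximize the profit `v T - ∑ j ∈ T, p j` at the item prices `p`. -/
def demand {m : ℕ} (v : Valuation m) (p : Fin m → ℝ) : Set (Finset (Fin m)) :=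
  {S | ∀ T : Finset (Fin m), v T - ∑ j ∈ T, p j ≤ v S - ∑ j ∈ S, p j}

/-- The gross substitutes property: when prices rise from `p` to `p'`, every demanded bundle `S`
admits a bundle demanded at `p'` that still contains all items of `S` whose price is unchanged. -/
def GrossSubstitutes {m : ℕ} (v : Valuation m) : Prop :=
  ∀ p p' : Fin m → ℝ, p ≤ p' → ∀ S ∈ demand v p,
    ∃ S' ∈ demand v p', ∀ j ∈ S, p j = p' j → j ∈ S'

/-- The class of normalized, non-decreasing valuations with the gross substitutes property. -/
def grossSubstitutesValuations (m : ℕ) : Set (Valuation m) :=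
  {v | v ∅ = 0 ∧ Monotone v ∧ GrossSubstitutes v}

/-- An allocation of (some of) the items `Fin m` to the bidders `Fin n`. -/
@[ext]
structure Allocation (n m : ℕ) where
  /-- the bundle of each bidder -/
  bundle : Fin n → Finset (Fin m)
  disjoint : ∀ i i' : Fin n, i ≠ i' → Disjoint (bundle i) (bundle i')

/-- The social welfare of an allocation. -/
def welfare {n m : ℕ} (v : Fin n → Valuation m) (T : Allocation n m) : ℝ :=
  ∑ i, v i (T.bundle i)

/-- A simultaneous algorithm with `n` bidders, `m` items and shared random coins `ω : Ω`. Each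
bidder sends one bit string, which depends only on the coins and on the bidder's own valuation; the
allocation depends only on the coins and on the messages. A deterministic algorithm is the case in
which `Ω` has one point; private coins are the case in which `Ω` is a product with one factor for
each bidder and one for the allocation rule. -/
structure SimultaneousAlgorithm (Ω : Type*) (n m : ℕ) where
  /-- the message of each bidder -/
  message : Ω → Fin n → Valuation m → List Bool
  /-- the allocation chosen from the messages -/
  allocate : Ω → (Fin n → List Bool) → Allocation n m

namespace SimultaneousAlgorithm

variable {Ω : Type*} {n m : ℕ}

/-- The allocation that the algorithm produces with coins `ω` on the profile `v`. -/
def run (A : SimultaneousAlgorithm Ω n m) (ω : Ω) (v : Fin n → Valuation m) : Allocation n m :=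
  A.allocate ω (fun i => A.message ω i (v i))

/-- The total number of bits sent by all bidders. -/
def bits (A : SimultaneousAlgorithm Ω n m) (ω : Ω) (v : Fin n → Valuation m) : ℕ :=
  ∑ i, (A.message ω i (v i)).length

/-- On every profile from `𝒱`, the resulting allocation is a random variable. -/
def IsMeasurableOn [MeasurableSpace Ω] (A : SimultaneousAlgorithm Ω n m)
    (𝒱 : Set (Valuation m)) : Prop :=
  ∀ v : Fin n → Valuation m, (∀ i, v i ∈ 𝒱) →
    ∀ T : Allocation n m, MeasurableSet {ω | A.run ω v = T}

/-- `A` is an `α`-approximation on the class `𝒱`: on every profile from `𝒱`, the welfare of every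
allocation is at most `α` times the expected welfare of the allocation that `A` produces. -/
def Approximates [MeasurableSpace Ω] (A : SimultaneousAlgorithm Ω n m) (μ : Measure Ω)
    (𝒱 : Set (Valuation m)) (α : ℝ) : Prop :=
  ∀ v : Fin n → Valuation m, (∀ i, v i ∈ 𝒱) →
    ∀ T : Allocation n m, welfare v T ≤ α * ∫ ω, welfare v (A.run ω v) ∂μ

end SimultaneousAlgorithm

end SimAuction

end

noncomputable section

namespace SimAuction

/-! Matroid ranks are gross substitutes (`matroidRankValuations_subset`), so it suffices to defeat
algorithms on matroid ranks, and by averaging on one distribution over matroid rank profiles.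

Bidders are split into `G` groups of `N`. A group sees a plane over `ZMod p` embedded into the
items, and a random function `h` from polynomials of degree below `d` to its bidders. Bidder `ν` has
a matroid in which the graph of a polynomial `c` is independent (rank `p`) if `h c = ν`, and has
rank at most `3 * q` otherwise. Such matroids exist for every `h` because distinct graphs meet in
few points, so that unions of few graphs are almost disjoint (`sparseMatroid`). In each group one
secret random polynomial has its graph on items private to the group, whereas the rest of the plane
lies on `p * p` items shared by all groups. Giving each group its private items, through the bidder
named by `h`, yields welfare `G * p`.

A random relabelling of the items makes the plane seen by a group independent of the secret
polynomial (`sum_perm_embedding`). Hence the group's messages would have to reveal `h` at almost all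
of the `p ^ d` polynomials, while short messages reveal only about a `1 / N` fraction, which blind
guessing achieves as well (`exists_guess_bound`). The algorithm thus collects at most `p * p` from
shared items, `3 * q` from each bidder, and a small share of `G * p` (`sum_welfare_run_le`). The
parameters make this too small for the claimed approximation factor. -/

/-- The rank function of `M`, as a valuation. -/
def rankValuation {m : ℕ} (M : Matroid (Fin m)) : Valuation m :=
  fun S => ((M.eRk (S : Set (Fin m))).toNat : ℝ)

/-! ### Matroid rank functions are gross substitutes -/

section MatroidRank

variable {α : Type*}

lemma coe_toNat_eRk (M : Matroid α) (S : Finset α) :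
    ((M.eRk (S : Set α)).toNat : ℕ∞) = M.eRk (S : Set α) := by
  refine ENat.natCast_toNat (ne_top_of_le_ne_top ?_ (M.eRk_le_encard (S : Set α)))
  simp

lemma toNat_eRk_mono (M : Matroid α) {S T : Finset α} (h : S ⊆ T) :
    (M.eRk (S : Set α)).toNat ≤ (M.eRk (T : Set α)).toNat := by
  rw [← ENat.natCast_le_natCast, coe_toNat_eRk, coe_toNat_eRk]
  exact M.eRk_mono (by exact_mod_cast h)

lemma toNat_eRk_insert_of_notMem_closure [DecidableEq α] (M : Matroid α) (hM : M.E = Set.univ)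
    {S : Finset α} {e : α} (he : e ∉ M.closure (S : Set α)) :
    (M.eRk ((insert e S : Finset α) : Set α)).toNat = (M.eRk (S : Set α)).toNat + 1 := by
  rw [← ENat.natCast_inj, Nat.cast_add, coe_toNat_eRk, coe_toNat_eRk, Finset.coe_insert]
  exact M.eRk_insert_eq_add_one ⟨by simp [hM], he⟩

lemma toNat_eRk_insert_of_mem_closure [DecidableEq α] (M : Matroid α)
    {S : Finset α} {e : α} (he : e ∈ M.closure (S : Set α)) :
    (M.eRk ((insert e S : Finset α) : Set α)).toNat = (M.eRk (S : Set α)).toNat := by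
  rw [← ENat.natCast_inj, coe_toNat_eRk, coe_toNat_eRk, Finset.coe_insert]
  rw [← M.eRk_closure_eq, Matroid.closure_insert_eq_of_mem_closure he, M.eRk_closure_eq]

lemma toNat_eRk_le_iff (M : Matroid α) (S : Finset α) (c : ℕ) :
    (M.eRk (S : Set α)).toNat ≤ c ↔
      ∀ I : Finset α, I ⊆ S → M.Indep (I : Set α) → I.card ≤ c := by
  rw [← ENat.natCast_le_natCast, coe_toNat_eRk, Matroid.eRk_le_iff]
  constructor
  · intro h I hIS hI
    have := h (I := (I : Set α)) (by exact_mod_cast hIS) hI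
    rw [Set.encard_coe_eq_coe_finsetCard] at this
    exact_mod_cast this
  · intro h I hIS hI
    obtain ⟨I, rfl⟩ := (S.finite_toSet.subset hIS).exists_finset_coe
    rw [Set.encard_coe_eq_coe_finsetCard]
    exact_mod_cast h I (by exact_mod_cast hIS) hI

lemma toNat_eRk_of_indep (M : Matroid α) {S : Finset α} (h : M.Indep (S : Set α)) :
    (M.eRk (S : Set α)).toNat = S.card := by
  rw [h.eRk_eq_encard, Set.encard_coe_eq_coe_finsetCard, ENat.toNat_natCast]

/-- The exchange property (M♮-concavity) of matroid rank functions. -/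
lemma toNat_eRk_exchange [DecidableEq α] (M : Matroid α) (hM : M.E = Set.univ) (S T : Finset α)
    {j : α} (hjS : j ∈ S) (hjT : j ∉ T) :
    (M.eRk (S : Set α)).toNat + (M.eRk (T : Set α)).toNat ≤
        (M.eRk (S.erase j : Finset α)).toNat + (M.eRk (insert j T : Finset α)).toNat ∨
      ∃ l ∈ T, l ∉ S ∧
        (M.eRk (S : Set α)).toNat + (M.eRk (T : Set α)).toNat ≤
          (M.eRk (insert l (S.erase j) : Finset α)).toNat +
            (M.eRk ((insert j T).erase l : Finset α)).toNat := by
  have hS : insert j (S.erase j) = S := Finset.insert_erase hjS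
  by_cases h1 : j ∈ M.closure ((S.erase j : Finset α) : Set α)
  · left
    have := toNat_eRk_insert_of_mem_closure M h1
    rw [hS] at this
    have := toNat_eRk_mono M (Finset.subset_insert j T)
    omega
  have hSr := toNat_eRk_insert_of_notMem_closure M hM h1
  rw [hS] at hSr
  by_cases h2 : j ∈ M.closure (T : Set α)
  swap
  · left
    have := toNat_eRk_insert_of_notMem_closure M hM h2
    omega
  right
  obtain ⟨C, hCT, hC, hjC⟩ := Matroid.exists_isCircuit_of_mem_closure h2 (by simpa using hjT)
  -- If all of the circuit except `j` lay in the closure of `S.erase j`, then so would `j`.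
  have hex : ∃ l ∈ C \ {j}, l ∉ M.closure ((S.erase j : Finset α) : Set α) := by
    by_contra hcon
    push Not at hcon
    exact h1 (M.closure_subset_closure_of_subset_closure hcon
      (hC.mem_closure_sdiff_singleton_of_mem hjC))
  obtain ⟨l, ⟨hlC, hlj⟩, hl⟩ := hex
  have hlj : l ≠ j := by simpa using hlj
  have hlT : l ∈ T := by simpa [hlj] using hCT hlC
  refine ⟨l, hlT, fun hlS => hl ?_, ?_⟩
  · exact M.mem_closure_of_mem' (by simp [hlS, hlj]) (by simp [hM])
  have e1 := toNat_eRk_insert_of_notMem_closure M hM hl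
  have hlcl : l ∈ M.closure (((insert j T).erase l : Finset α) : Set α) := by
    refine M.closure_subset_closure ?_ (hC.mem_closure_sdiff_singleton_of_mem hlC)
    intro x hx
    have := hCT hx.1
    have hxl : x ≠ l := by simpa using hx.2
    simpa [hxl] using this
  have e2 := toNat_eRk_insert_of_mem_closure M hlcl
  rw [Finset.insert_erase (Finset.mem_insert_of_mem hlT)] at e2
  have := toNat_eRk_mono M (Finset.subset_insert j T)
  omega

end MatroidRank

lemma sum_erase_add {m : ℕ} (p : Fin m → ℝ) {S : Finset (Fin m)} {j : Fin m} (hj : j ∈ S) :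
    ∑ i ∈ S, p i = ∑ i ∈ S.erase j, p i + p j := (Finset.sum_erase_add S p hj).symm

/-- Among the bundles demanded at `p'`, take one that misses the fewest items of `S` with unchanged
price. If it misses `j`, the exchange property together with optimality of `S` at `p` gives a
demanded bundle that misses fewer; a returned item `l` only helps, since its price did not fall. -/
lemma grossSubstitutes_rankValuation {m : ℕ} (M : Matroid (Fin m)) (hM : M.E = Set.univ) :
    GrossSubstitutes (rankValuation M) := by
  intro p p' hp S hS
  have hne : ∃ S', S' ∈ demand (rankValuation M) p' := by
    obtain ⟨S', hS'⟩ := Finite.exists_max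
      (fun T : Finset (Fin m) => rankValuation M T - ∑ j ∈ T, p' j)
    exact ⟨S', hS'⟩
  let D : Finset (Fin m) := S.filter (fun j => p j = p' j)
  obtain ⟨S', hS', hmin⟩ := Set.exists_min_image (demand (rankValuation M) p')
    (fun T => (D \ T).card) (Set.toFinite _) hne
  refine ⟨S', hS', fun j hjS hpj => ?_⟩
  by_contra hjS'
  have hjD : j ∈ D := by simp [D, hjS, hpj]
  have hlt : ∀ T : Finset (Fin m), D \ T ⊆ D \ S' → j ∈ T →
      T ∉ demand (rankValuation M) p' := by
    intro T hT hjT hTd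
    have h1 := hmin T hTd
    have h2 : (D \ T).card < (D \ S').card := by
      refine Finset.card_lt_card ⟨hT, fun h => ?_⟩
      have := h (Finset.mem_sdiff.2 ⟨hjD, hjS'⟩)
      simp [hjT] at this
    omega
  rcases toNat_eRk_exchange M hM S S' hjS hjS' with h | ⟨l, hlS', hlS, h⟩
  · refine hlt (insert j S') (by grind) (by simp) fun T => (hS' T).trans ?_
    have h1 := hS (S.erase j)
    rw [sum_erase_add p hjS] at h1
    rw [Finset.sum_insert hjS']
    have h' : rankValuation M S + rankValuation M S' ≤
        rankValuation M (S.erase j) + rankValuation M (insert j S') := by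
      unfold rankValuation; exact_mod_cast h
    linarith
  · have hlj : l ≠ j := fun h => hlS (h ▸ hjS)
    refine hlt ((insert j S').erase l) ?_ (by simp [hlj.symm]) fun T => (hS' T).trans ?_
    · intro x hx
      simp only [Finset.mem_sdiff, Finset.mem_erase, Finset.mem_insert, D, Finset.mem_filter] at hx ⊢
      refine ⟨hx.1, fun hxS' => hx.2 ⟨?_, Or.inr hxS'⟩⟩
      rintro rfl
      exact hlS hx.1.1
    have h1 := hS (insert l (S.erase j))
    rw [sum_erase_add p hjS, Finset.sum_insert (by simp [hlS])] at h1
    have h2 := sum_erase_add p' (Finset.mem_insert_of_mem hlS' : l ∈ insert j S')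
    rw [Finset.sum_insert hjS'] at h2
    have h' : rankValuation M S + rankValuation M S' ≤
        rankValuation M (insert l (S.erase j)) + rankValuation M ((insert j S').erase l) := by
      unfold rankValuation; exact_mod_cast h
    have := hp l
    linarith

lemma matroidRankValuations_subset (m : ℕ) :
    matroidRankValuations m ⊆ grossSubstitutesValuations m := by
  rintro v ⟨M, hM, hv⟩
  have hv : v = rankValuation M := funext hv
  subst hv
  refine ⟨by simp [rankValuation], fun S T h => ?_, grossSubstitutes_rankValuation M hM⟩
  exact Nat.cast_le.2 (toNat_eRk_mono M h)

/-! ### Matroids with prescribed sets of low rank -/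

section SparseMatroid

open Finset

variable {α ι : Type*} [DecidableEq α]

/-- The set `I` has at most `k` elements, all of them in `U`, and it respects the rank bounds that
rank at most `r` of each of the `k`-sets `A j`, `j ∈ B`, imposes on small unions of these sets. -/
def SparseIndep (U : Finset α) (A : ι → Finset α) (B : Finset ι) (k r τ : ℕ) (I : Finset α) :
    Prop :=
  I ⊆ U ∧ I.card ≤ k ∧ ∀ J ⊆ B, J.card < τ →
    (I ∩ J.biUnion A).card + k * J.card ≤ (J.biUnion A).card + r * J.card

variable {U : Finset α} {A : ι → Finset α} {B : Finset ι} {k q τ : ℕ}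

lemma SparseIndep.subset {r : ℕ} {I I' : Finset α} (h : SparseIndep U A B k r τ I')
    (hI : I ⊆ I') : SparseIndep U A B k r τ I :=
  ⟨hI.trans h.1, (card_le_card hI).trans h.2.1, fun J hJ hJτ =>
    (Nat.add_le_add_right (card_le_card (inter_subset_inter_right hI)) _).trans (h.2.2 J hJ hJτ)⟩

lemma sparseIndep_empty
    (hexp : ∀ J : Finset ι, J.card ≤ 2 * τ → k * J.card ≤ (J.biUnion A).card + q * J.card) :
    SparseIndep U A B k (3 * q) τ ∅ := by
  refine ⟨by simp, by simp, fun J _ hJτ => ?_⟩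
  have := hexp J (by omega)
  simp only [empty_inter, card_empty]
  nlinarith [Nat.zero_le (q * J.card)]

lemma SparseIndep.card_inter_le {r : ℕ} {I : Finset α} (h : SparseIndep U A B k r τ I)
    (hτ : 1 < τ) {j : ι} (hj : j ∈ B) (hA : (A j).card = k) : (I ∩ A j).card ≤ r := by
  have := h.2.2 {j} (by simpa using hj) (by simpa using hτ)
  simp only [singleton_biUnion, card_singleton, hA] at this
  omega

variable [DecidableEq ι]

/-- Tight constraints are closed under union. -/
lemma sparse_tight_union {r : ℕ} {I : Finset α} (h : SparseIndep U A B k r τ I) {J J' : Finset ι}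
    (hJ : J ⊆ B) (hJτ : J.card < τ)
    (t : (J.biUnion A).card + r * J.card ≤ (I ∩ J.biUnion A).card + k * J.card)
    (t' : (J'.biUnion A).card + r * J'.card ≤ (I ∩ J'.biUnion A).card + k * J'.card) :
    ((J ∪ J').biUnion A).card + r * (J ∪ J').card ≤
      (I ∩ (J ∪ J').biUnion A).card + k * (J ∪ J').card := by
  have h0 := h.2.2 (J ∩ J') (inter_subset_left.trans hJ)
    ((card_le_card inter_subset_left).trans_lt hJτ)
  rw [union_biUnion, inter_union_distrib_left]
  set X := J.biUnion A
  set Y := J'.biUnion A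
  set Z := (J ∩ J').biUnion A
  have hZ : Z ⊆ X ∩ Y := subset_inter (biUnion_subset_biUnion_of_subset_left _ inter_subset_left)
    (biUnion_subset_biUnion_of_subset_left _ inter_subset_right)
  have c1 := card_union_add_card_inter X Y
  have c2 := card_union_add_card_inter (I ∩ X) (I ∩ Y)
  have c3 := card_union_add_card_inter J J'
  -- `X ∩ Y` may exceed `Z`. The excess enters the count for `I` at most once, and it lowers the
  -- cardinality of `X ∪ Y` by the same amount.
  have c4 : (I ∩ X ∩ (I ∩ Y)).card ≤ (I ∩ Z).card + ((X ∩ Y) \ Z).card := by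
    rw [← inter_inter_distrib_left]
    refine (card_le_card ?_).trans (card_union_le _ _)
    intro x hx
    by_cases hxZ : x ∈ Z <;> simp_all
  have c5 := card_sdiff_add_card_eq_card hZ
  have c6 : r * (J ∪ J').card + r * (J ∩ J').card = r * J.card + r * J'.card := by
    rw [← mul_add, c3, mul_add]
  have c7 : k * (J ∪ J').card + k * (J ∩ J').card = k * J.card + k * J'.card := by
    rw [← mul_add, c3, mul_add]
  omega

/-- If no element can be added, each element of `I' \ I` lies in a tight union. Tight families merge
into one that covers `I' \ I`; its constraint holds for `I'` and is tight for `I`, so `I'` is no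
larger than `I`. -/
lemma sparseIndep_augment (hq : k ≤ 2 * q * τ)
    (hexp : ∀ J : Finset ι, J.card ≤ 2 * τ → k * J.card ≤ (J.biUnion A).card + q * J.card)
    {I I' : Finset α} (hI : SparseIndep U A B k (3 * q) τ I)
    (hI' : SparseIndep U A B k (3 * q) τ I') (hlt : I.card < I'.card) :
    ∃ x ∈ I', x ∉ I ∧ SparseIndep U A B k (3 * q) τ (insert x I) := by
  by_contra hcon
  push Not at hcon
  have hIk : I.card < k := hlt.trans_le hI'.2.1
  let P : Finset ι → Prop := fun J => J ⊆ B ∧ J.card < τ ∧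
    (J.biUnion A).card + 3 * q * J.card ≤ (I ∩ J.biUnion A).card + k * J.card
  have hunion : ∀ J J', P J → P J' → P (J ∪ J') := by
    intro J J' h h'
    have ht := sparse_tight_union hI h.1 h.2.1 h.2.2 h'.2.2
    refine ⟨union_subset h.1 h'.1, ?_, ht⟩
    by_contra hτ
    push Not at hτ
    -- A tight family with at least `τ` members would force `I` to have at least `(3 * q - q) * τ ≥
    -- k` elements. The union has fewer than `2 * τ` members, so expansion applies.
    have h1 := hexp (J ∪ J') ((card_union_le _ _).trans (by have := h.2.1; have := h'.2.1; omega))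
    have h2 : (I ∩ (J ∪ J').biUnion A).card ≤ I.card := card_le_card inter_subset_left
    have h3 : 2 * q * τ ≤ 2 * q * (J ∪ J').card := Nat.mul_le_mul_left _ hτ
    nlinarith
  have htight : ∀ x ∈ I' \ I, ∃ J, P J ∧ x ∈ J.biUnion A := by
    intro x hx
    rw [mem_sdiff] at hx
    have h1 := hcon x hx.1 hx.2
    by_contra hno
    push Not at hno
    refine h1 ⟨insert_subset (hI'.1 hx.1) hI.1, ?_, fun J hJ hJτ => ?_⟩
    · rw [card_insert_of_notMem hx.2]; exact hIk
    by_cases hxJ : x ∈ J.biUnion A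
    · have h2 : ¬ P J := fun hP => hno J hP hxJ
      have h3 : ¬ ((J.biUnion A).card + 3 * q * J.card ≤
        (I ∩ J.biUnion A).card + k * J.card) := fun h => h2 ⟨hJ, hJτ, h⟩
      rw [insert_inter_of_mem hxJ]
      have := card_insert_le x (I ∩ J.biUnion A)
      omega
    · rw [insert_inter_of_notMem hxJ]
      exact hI.2.2 J hJ hJτ
  have hcover : ∀ X ⊆ I' \ I, X.Nonempty → ∃ J, P J ∧ X ⊆ J.biUnion A := by
    intro X
    induction X using Finset.induction_on with
    | empty => intro _ h; simp at h
    | insert x X hx ih =>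
      intro hX _
      obtain ⟨J, hJ, hxJ⟩ := htight x (hX (mem_insert_self _ _))
      rcases X.eq_empty_or_nonempty with rfl | hne
      · exact ⟨J, hJ, by simpa using hxJ⟩
      obtain ⟨J', hJ', hXJ'⟩ := ih ((subset_insert _ _).trans hX) hne
      refine ⟨J ∪ J', hunion _ _ hJ hJ', ?_⟩
      rw [union_biUnion]
      exact insert_subset (mem_union_left _ hxJ) (hXJ'.trans subset_union_right)
  have hne : (I' \ I).Nonempty := by
    rw [sdiff_nonempty]
    intro h
    have := card_le_card h
    omega
  obtain ⟨J, hJ, hcov⟩ := hcover _ subset_rfl hne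
  have h1 := hI'.2.2 J hJ.1 hJ.2.1
  have h2 : I' \ J.biUnion A ⊆ I \ J.biUnion A := by
    intro x hx
    rw [mem_sdiff] at hx ⊢
    refine ⟨?_, hx.2⟩
    by_contra hxI
    exact hx.2 (hcov (mem_sdiff.2 ⟨hx.1, hxI⟩))
  have h3 := card_le_card h2
  have h4 := card_inter_add_card_sdiff I (J.biUnion A)
  have h5 := card_inter_add_card_sdiff I' (J.biUnion A)
  have := hJ.2.2
  omega

/-- A matroid of rank at most `k` in which the sets `A j`, `j ∈ B`, have rank at most `3 * q`,
whereas the other `A j` are independent. -/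
def sparseMatroid (U : Finset α) (A : ι → Finset α) (B : Finset ι) (hq : k ≤ 2 * q * τ)
    (hexp : ∀ J : Finset ι, J.card ≤ 2 * τ → k * J.card ≤ (J.biUnion A).card + q * J.card) :
    Matroid α :=
  (IndepMatroid.ofFinset Set.univ (SparseIndep U A B k (3 * q) τ) (sparseIndep_empty hexp)
    (fun _ _ h h' => h.subset h') (fun _ _ h h' hlt => sparseIndep_augment hq hexp h h' hlt)
    (fun _ _ => Set.subset_univ _)).matroid

lemma sparseMatroid_indep (hq : k ≤ 2 * q * τ)
    (hexp : ∀ J : Finset ι, J.card ≤ 2 * τ → k * J.card ≤ (J.biUnion A).card + q * J.card)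
    (I : Finset α) :
    (sparseMatroid U A B hq hexp).Indep (I : Set α) ↔ SparseIndep U A B k (3 * q) τ I :=
  IndepMatroid.ofFinset_indep Set.univ (SparseIndep U A B k (3 * q) τ) (sparseIndep_empty hexp)
    (fun _ _ h h' => h.subset h') (fun _ _ h h' hlt => sparseIndep_augment hq hexp h h' hlt)
    (fun _ _ => Set.subset_univ _)

/-- Expansion of `insert j J` bounds the overlap of `A j` with the union over `J` by its constraint
with `q * (J.card + 1)` as rank term, and this is at most `2 * q * J.card` for nonempty `J`. -/
lemma sparseIndep_member
    (hexp : ∀ J : Finset ι, J.card ≤ 2 * τ → k * J.card ≤ (J.biUnion A).card + q * J.card)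
    {j : ι} (hj : j ∉ B) (hA : (A j).card = k) (hU : A j ⊆ U) :
    SparseIndep U A B k (3 * q) τ (A j) := by
  refine ⟨hU, hA.le, fun J hJ hJτ => ?_⟩
  rcases J.eq_empty_or_nonempty with rfl | hne
  · simp
  have hjJ : j ∉ J := fun h => hj (hJ h)
  have h1 := hexp (insert j J) (by rw [card_insert_of_notMem hjJ]; omega)
  rw [card_insert_of_notMem hjJ, biUnion_insert] at h1
  have h2 := card_union_add_card_inter (A j) (J.biUnion A)
  have h3 := hexp J (by omega)
  have h4 : 1 ≤ J.card := hne.card_pos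
  nlinarith [Nat.mul_le_mul_left q h4]

/-- Sets of size `k` with small pairwise intersections have large unions. -/
lemma mul_card_le_card_biUnion {e : ℕ} (hA : ∀ j, (A j).card = k)
    (hint : ∀ i j, i ≠ j → (A i ∩ A j).card ≤ e) (J : Finset ι) :
    k * J.card ≤ (J.biUnion A).card + e * J.card * J.card := by
  induction J using Finset.induction_on with
  | empty => simp
  | insert j J hj ih =>
    rw [card_insert_of_notMem hj, biUnion_insert]
    have h1 := card_union_add_card_inter (A j) (J.biUnion A)
    have h2 : (A j ∩ J.biUnion A).card ≤ e * J.card := by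
      rw [inter_biUnion]
      refine card_biUnion_le.trans ?_
      rw [mul_comm, ← smul_eq_mul]
      exact sum_le_card_nsmul _ _ _ fun i hi => hint j i (fun h => hj (h ▸ hi))
    rw [hA j] at h1
    nlinarith

end SparseMatroid

/-! ### Graphs of low-degree polynomials -/

section PolynomialGraphs

variable {p d : ℕ} [Fact p.Prime]

/-- The value at `x` of the polynomial with coefficients `c`. -/
def polyValue (c : Fin d → ZMod p) (x : ZMod p) : ZMod p := ∑ i, c i * x ^ (i : ℕ)

/-- The graph of the polynomial with coefficients `c`. -/
def polyGraph (c : Fin d → ZMod p) : Finset (ZMod p × ZMod p) :=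
  Finset.univ.filter fun z => z.2 = polyValue c z.1

lemma mem_polyGraph {c : Fin d → ZMod p} {z : ZMod p × ZMod p} :
    z ∈ polyGraph c ↔ z.2 = polyValue c z.1 := by
  simp [polyGraph]

lemma card_polyGraph (c : Fin d → ZMod p) : (polyGraph c).card = p := by
  have h : (polyGraph c).card = (Finset.univ : Finset (ZMod p)).card := by
    refine Finset.card_bij' (fun z _ => z.1) (fun x _ => (x, polyValue c x)) ?_ ?_ ?_ ?_
    · simp
    · simp [mem_polyGraph]
    · intro z hz; rw [← mem_polyGraph.1 hz]
    · simp
  rw [h, Finset.card_univ, ZMod.card]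

lemma card_polyGraph_inter_le {c c' : Fin d → ZMod p} (h : c ≠ c') :
    (polyGraph c ∩ polyGraph c').card ≤ d - 1 := by
  let P : Polynomial (ZMod p) := ∑ i : Fin d, Polynomial.monomial (i : ℕ) (c i - c' i)
  have hcoeff : ∀ i : Fin d, P.coeff i = c i - c' i := by
    intro i
    simp only [P, Polynomial.finsetSum_coeff, Polynomial.coeff_monomial]
    rw [Finset.sum_eq_single i]
    · simp
    · intro b _ hb; rw [if_neg]; exact fun h => hb (Fin.ext h)
    · simp
  have hP : P ≠ 0 := by
    intro h0
    refine h (funext fun i => ?_)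
    have := hcoeff i
    rw [h0, Polynomial.coeff_zero] at this
    exact (sub_eq_zero.1 this.symm)
  have heval : ∀ x, P.eval x = polyValue c x - polyValue c' x := by
    intro x
    simp [P, Polynomial.eval_finsetSum, polyValue, Finset.sum_sub_distrib]
  have hdeg : P.natDegree ≤ d - 1 := by
    refine Polynomial.natDegree_sum_le_of_forall_le _ _ fun i _ => ?_
    refine (Polynomial.natDegree_monomial_le _).trans ?_
    have := i.2
    omega
  calc (polyGraph c ∩ polyGraph c').card ≤ P.roots.toFinset.card := by
        refine Finset.card_le_card_of_injOn Prod.fst ?_ ?_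
        · intro z hz
          rw [Finset.mem_coe, Finset.mem_inter, mem_polyGraph, mem_polyGraph] at hz
          have h0 : P.eval z.1 = 0 := by rw [heval, ← hz.1, ← hz.2, sub_self]
          simp [hP, Polynomial.IsRoot, h0]
        · intro z hz w hw hzw
          rw [Finset.mem_coe, Finset.mem_inter, mem_polyGraph] at hz hw
          exact Prod.ext hzw (by rw [hz.1, hw.1, hzw])
    _ ≤ P.roots.card := Multiset.toFinset_card_le _
    _ ≤ P.natDegree := P.card_roots'
    _ ≤ d - 1 := hdeg

/-- The shear of the plane that maps the horizontal axis to the graph of the polynomial. -/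
def shear (c : Fin d → ZMod p) : Equiv.Perm (ZMod p × ZMod p) where
  toFun z := (z.1, z.2 + polyValue c z.1)
  invFun z := (z.1, z.2 - polyValue c z.1)
  left_inv z := by simp
  right_inv z := by simp

end PolynomialGraphs

/-! ### Guessing a random function from a short message -/

section Guessing

open Finset

variable {F V Y : Type*} [Fintype F] [Fintype V] [DecidableEq F] [DecidableEq V] [DecidableEq Y]

/-- The sum factors over the coordinates: the guessed value contributes 2 and every other value 1.
It is an exponential moment, suited to a union bound over messages. -/
lemma sum_two_pow_agreement (x : F → V) :
    ∑ h : F → V, 2 ^ (univ.filter fun j => h j = x j).card =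
      (Fintype.card V + 1) ^ Fintype.card F := by
  have h1 : ∀ h : F → V, 2 ^ (univ.filter fun j => h j = x j).card =
      ∏ j, (if h j = x j then 2 else 1) := by
    intro h
    rw [prod_ite, prod_const, prod_const_one, mul_one]
  have h2 : ∀ j : F, ∑ v : V, (if v = x j then 2 else 1) = Fintype.card V + 1 := by
    intro j
    have h3 : ∀ v : V, (if v = x j then 2 else 1) = (if v = x j then 1 else 0) + 1 := by
      intro v; split_ifs <;> rfl
    rw [sum_congr rfl fun v _ => h3 v, sum_add_distrib, sum_ite_eq' univ (x j)]
    simp [add_comm]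
  rw [sum_congr rfl fun h _ => h1 h]
  have h4 := Finset.prod_univ_sum (fun _ : F => (univ : Finset V))
    (fun j v => if v = x j then 2 else 1)
  rw [Fintype.piFinset_univ] at h4
  rw [← h4, prod_congr rfl fun j _ => h2 j, prod_const, card_univ]

/-- Few messages about a uniformly random function do not allow to guess many of its values. -/
lemma sum_agreement_le (π : (F → V) → Y) (x : Y → F → V) {c : ℕ}
    (hc : (univ.image π).card * (Fintype.card V + 1) ^ Fintype.card F ≤
      2 ^ c * Fintype.card V ^ Fintype.card F) :
    ∑ h : F → V, (univ.filter fun j => h j = x (π h) j).card ≤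
      Fintype.card V ^ Fintype.card F * (c + 1) := by
  -- This is `a ≤ c + 2 ^ (a - c)`, which stands in for Jensen's inequality when passing from the
  -- exponential moment to the mean.
  have h1 : ∀ a : ℕ, 2 ^ c * a ≤ 2 ^ c * c + 2 ^ a := by
    intro a
    rcases le_total a c with h | h
    · exact (Nat.mul_le_mul_left _ h).trans (Nat.le_add_right _ _)
    · obtain ⟨b, rfl⟩ := Nat.exists_eq_add_of_le h
      rw [mul_add, pow_add]
      have := Nat.mul_le_mul_left (2 ^ c) (Nat.lt_two_pow_self (n := b)).le
      omega
  have h2 : ∑ h : F → V, 2 ^ (univ.filter fun j => h j = x (π h) j).card ≤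
      2 ^ c * Fintype.card V ^ Fintype.card F := by
    refine le_trans ?_ hc
    calc ∑ h : F → V, 2 ^ (univ.filter fun j => h j = x (π h) j).card
        ≤ ∑ h : F → V, ∑ y ∈ univ.image π, 2 ^ (univ.filter fun j => h j = x y j).card :=
          sum_le_sum fun h _ => single_le_sum
            (f := fun y => 2 ^ (univ.filter fun j => h j = x y j).card)
            (fun _ _ => Nat.zero_le _) (mem_image_of_mem π (mem_univ h))
      _ = (univ.image π).card * (Fintype.card V + 1) ^ Fintype.card F := by
          rw [sum_comm, sum_congr rfl fun y _ => sum_two_pow_agreement (x y), sum_const,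
            smul_eq_mul]
  have h3 : 2 ^ c * ∑ h : F → V, (univ.filter fun j => h j = x (π h) j).card ≤
      2 ^ c * (Fintype.card V ^ Fintype.card F * (c + 1)) := by
    calc 2 ^ c * ∑ h : F → V, (univ.filter fun j => h j = x (π h) j).card
        ≤ ∑ h : F → V, (2 ^ c * c + 2 ^ (univ.filter fun j => h j = x (π h) j).card) := by
          rw [mul_sum]; exact sum_le_sum fun h _ => h1 _
      _ ≤ Fintype.card V ^ Fintype.card F * (2 ^ c * c) +
            2 ^ c * Fintype.card V ^ Fintype.card F := by
          rw [sum_add_distrib, sum_const, card_univ, Fintype.card_fun, smul_eq_mul]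
          exact Nat.add_le_add_left h2 _
      _ = _ := by ring
  exact Nat.le_of_mul_le_mul_left h3 (by positivity)

/-- `R j` counts the functions whose value at `j` the best guess from the message hits. It does not
depend on `W`, so one `R` serves every way of splitting `k` items according to the message. -/
lemma exists_guess_bound [Nonempty V] (π : (F → V) → Y) {c : ℕ}
    (hc : (univ.image π).card * (Fintype.card V + 1) ^ Fintype.card F ≤
      2 ^ c * Fintype.card V ^ Fintype.card F) :
    ∃ R : F → ℕ, ∑ j, R j ≤ Fintype.card V ^ Fintype.card F * (c + 1) ∧
      ∀ (j : F) (k : ℕ) (W : Y → V → ℕ), (∀ y, ∑ v, W y v ≤ k) →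
        ∑ h : F → V, W (π h) (h j) ≤ k * R j := by
  let cnt : Y → F → V → ℕ := fun y j v => (univ.filter fun h : F → V => (π h, h j) = (y, v)).card
  choose x hx using fun (y : Y) (j : F) => Finite.exists_max (cnt y j)
  refine ⟨fun j => (univ.filter fun h : F → V => h j = x (π h) j).card, ?_, ?_⟩
  · refine le_trans (le_of_eq ?_) (sum_agreement_le π x hc)
    simp only [card_filter]
    exact sum_comm
  · intro j k W hW
    have h1 : (univ.filter fun h : F → V => h j = x (π h) j).card =
        ∑ y ∈ univ.image π, cnt y j (x y j) := by
      rw [card_eq_sum_card_fiberwise (f := π) (t := univ.image π)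
        (fun h _ => mem_image_of_mem π (mem_univ h))]
      refine sum_congr rfl fun y _ => congrArg card ?_
      ext h
      simp only [mem_filter, mem_univ, true_and, Prod.mk.injEq]
      constructor
      · rintro ⟨a, rfl⟩; exact ⟨rfl, a⟩
      · rintro ⟨rfl, a⟩; exact ⟨a, rfl⟩
    beta_reduce
    rw [h1, ← sum_fiberwise_of_maps_to (s := univ) (t := univ.image π ×ˢ (univ : Finset V))
      (g := fun h : F → V => (π h, h j)) (by simp), sum_product, mul_sum]
    refine sum_le_sum fun y _ => ?_
    calc ∑ v, ∑ h with (π h, h j) = (y, v), W (π h) (h j) = ∑ v, cnt y j v * W y v := by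
          refine sum_congr rfl fun v _ => ?_
          rw [← smul_eq_mul, ← sum_const]
          refine sum_congr rfl fun h hh => ?_
          simp only [mem_filter, mem_univ, true_and, Prod.mk.injEq] at hh
          rw [hh.1, hh.2]
      _ ≤ ∑ v, cnt y j (x y j) * W y v :=
          sum_le_sum fun v _ => Nat.mul_le_mul_right _ (hx y j v)
      _ ≤ k * cnt y j (x y j) := by
          rw [← mul_sum, mul_comm]; exact Nat.mul_le_mul_right _ (hW y)

end Guessing

/-! ### Symmetries of the random choices -/

section Averaging

open Finset

/-- Resampling one coordinate of a uniformly random function. -/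
lemma sum_mul_card_eq_sum_update {I D : Type*} [Fintype I] [DecidableEq I] [Fintype D]
    (g : I) (X : (I → D) → ℕ) :
    (∑ x, X x) * Fintype.card D = ∑ x, ∑ a, X (Function.update x g a) := by
  -- The involution swaps the coordinate `g` of the function with the fresh sample.
  let e : (I → D) × D → (I → D) × D := fun z => (Function.update z.1 g z.2, z.1 g)
  have he : Function.Involutive e := by intro z; simp [e]
  have h := Equiv.sum_comp he.toPerm (fun z => X z.1)
  rw [Fintype.sum_prod_type, Fintype.sum_prod_type] at h
  simp only [sum_const, card_univ, smul_eq_mul] at h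
  rw [sum_mul, sum_congr rfl fun x _ => mul_comm (X x) _, ← h]
  rfl

/-- A uniformly random embedding is invariant under permutations of its domain. -/
lemma sum_perm_embedding {U E : Type*} [Fintype U] [DecidableEq U] [Fintype E] [DecidableEq E]
    (ψ : U ↪ E) (e : Equiv.Perm U) (Φ : (U ↪ E) → ℕ) :
    ∑ σ : Equiv.Perm E, Φ (e.toEmbedding.trans (ψ.trans σ.toEmbedding)) =
      ∑ σ : Equiv.Perm E, Φ (ψ.trans σ.toEmbedding) := by
  rw [← Equiv.sum_comp (Equiv.mulRight (e.viaFintypeEmbedding ψ))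
    (fun σ : Equiv.Perm E => Φ (ψ.trans σ.toEmbedding))]
  refine sum_congr rfl fun σ _ => congrArg Φ ?_
  ext u
  simp [Equiv.Perm.viaFintypeEmbedding_apply_image]

end Averaging

/-! ### Counting messages -/

section MessageCount

open Finset

/-- There are at most `((L + 1) * 2 ^ L) ^ N` tuples of `N` bit strings of length at most `L`. -/
lemma card_image_messages_le {ι : Type*} [Fintype ι] {N L : ℕ} (π : ι → Fin N → List Bool)
    (hπ : ∀ a ν, (π a ν).length ≤ L) :
    (univ.image π).card ≤ ((L + 1) * 2 ^ L) ^ N := by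
  -- Strings are padded with `false`; the recorded length makes the padding reversible.
  let enc : List Bool → Fin (L + 1) × (Fin L → Bool) :=
    fun l => (Fin.ofNat (L + 1) l.length, fun i => l.getD i false)
  have henc : ∀ l l' : List Bool, l.length ≤ L → l'.length ≤ L → enc l = enc l' → l = l' := by
    intro l l' hl hl' h
    have h1 : l.length = l'.length := by
      have := congrArg (fun z => (z.1 : ℕ)) h
      simpa [enc, Fin.ofNat, Nat.mod_eq_of_lt (Nat.lt_succ_of_le hl),
        Nat.mod_eq_of_lt (Nat.lt_succ_of_le hl')] using this
    refine List.ext_getElem h1 fun i hi hi' => ?_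
    have := congrFun (congrArg Prod.snd h) ⟨i, hi.trans_le hl⟩
    simpa [enc, hi, hi'] using this
  have hle := card_le_card_of_injOn (s := univ.image π)
    (t := (univ : Finset (Fin N → Fin (L + 1) × (Fin L → Bool)))) (fun y ν => enc (y ν))
    (by simp) (by
      intro y hy y' hy' h
      simp only [coe_image, coe_univ, Set.image_univ, Set.mem_range] at hy hy'
      obtain ⟨a, rfl⟩ := hy
      obtain ⟨b, rfl⟩ := hy'
      exact funext fun ν => henc _ _ (hπ a ν) (hπ b ν) (congrFun h ν))
  simpa [card_univ] using hle

end MessageCount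

/-! ### The hard instance -/

section HardInstance

open Finset

variable {p d τ q G N n m : ℕ} [Fact p.Prime]

lemma polyGraph_expansion (hd : 2 * τ * (d - 1) ≤ q) (ψ : ZMod p × ZMod p ↪ Fin m)
    (J : Finset (Fin d → ZMod p)) (hJ : J.card ≤ 2 * τ) :
    p * J.card ≤ (J.biUnion fun c => (polyGraph c).map ψ).card + q * J.card := by
  have h := mul_card_le_card_biUnion (A := fun c : Fin d → ZMod p => (polyGraph c).map ψ)
    (k := p) (e := d - 1) (fun c => by rw [card_map, card_polyGraph])
    (fun c c' hcc => by
      rw [← map_inter, card_map]; exact card_polyGraph_inter_le hcc) J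
  refine h.trans (Nat.add_le_add_left (Nat.mul_le_mul_right _ (le_trans ?_ hd)) _)
  rw [mul_comm]
  exact Nat.mul_le_mul_right _ hJ

/-- The plane over `ZMod p` embedded into the items by `ψ`, with a matroid in which the graphs of
the polynomials in `B` have low rank, whereas the other graphs are independent. -/
def graphMatroid (hq : p ≤ 2 * q * τ) (hd : 2 * τ * (d - 1) ≤ q) (ψ : ZMod p × ZMod p ↪ Fin m)
    (B : Finset (Fin d → ZMod p)) : Matroid (Fin m) :=
  sparseMatroid (univ.map ψ) (fun c => (polyGraph c).map ψ) B hq (polyGraph_expansion hd ψ)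

/-- The rank of a bundle in `graphMatroid`. -/
def graphRank (hq : p ≤ 2 * q * τ) (hd : 2 * τ * (d - 1) ≤ q) (ψ : ZMod p × ZMod p ↪ Fin m)
    (B : Finset (Fin d → ZMod p)) (S : Finset (Fin m)) : ℕ :=
  ((graphMatroid hq hd ψ B).eRk (S : Set (Fin m))).toNat

lemma isMatroidRank_graphRank (hq : p ≤ 2 * q * τ) (hd : 2 * τ * (d - 1) ≤ q)
    (ψ : ZMod p × ZMod p ↪ Fin m) (B : Finset (Fin d → ZMod p)) :
    IsMatroidRank fun S => (graphRank hq hd ψ B S : ℝ) :=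
  ⟨graphMatroid hq hd ψ B, rfl, fun _ => rfl⟩

lemma isMatroidRank_zero : IsMatroidRank (fun _ => 0 : Valuation m) :=
  ⟨Matroid.loopyOn Set.univ, rfl, fun S => by simp⟩

lemma graphRank_eq_of_notMem (hq : p ≤ 2 * q * τ) (hd : 2 * τ * (d - 1) ≤ q)
    (ψ : ZMod p × ZMod p ↪ Fin m) {B : Finset (Fin d → ZMod p)} {c : Fin d → ZMod p}
    (hc : c ∉ B) : graphRank hq hd ψ B ((polyGraph c).map ψ) = p := by
  unfold graphRank
  rw [toNat_eRk_of_indep, card_map, card_polyGraph]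
  refine (sparseMatroid_indep ..).2 ?_
  exact sparseIndep_member (A := fun c => (polyGraph c).map ψ) (polyGraph_expansion hd ψ) hc
    (by rw [card_map, card_polyGraph]) (map_subset_map.2 (subset_univ _))

/-- An independent subset of `S` is split along the graph of `c`. If `c ∈ B`, the singleton
constraint caps the part on the graph; it is among the constraints because `1 < τ`. -/
lemma graphRank_le (hq : p ≤ 2 * q * τ) (hd : 2 * τ * (d - 1) ≤ q) (hτ : 1 < τ)
    (ψ : ZMod p × ZMod p ↪ Fin m) (B : Finset (Fin d → ZMod p)) (c : Fin d → ZMod p)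
    (S : Finset (Fin m)) :
    graphRank hq hd ψ B S ≤ (S ∩ (univ.map ψ \ (polyGraph c).map ψ)).card +
      if c ∈ B then 3 * q else (S ∩ (polyGraph c).map ψ).card := by
  refine (toNat_eRk_le_iff _ _ _).2 fun I hIS hI => ?_
  have hI : SparseIndep (univ.map ψ) (fun c => (polyGraph c).map ψ) B p (3 * q) τ I :=
    (sparseMatroid_indep ..).1 hI
  rw [← card_inter_add_card_sdiff I ((polyGraph c).map ψ), add_comm]
  refine Nat.add_le_add (card_le_card ?_) ?_
  · intro x hx
    rw [mem_sdiff] at hx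
    exact mem_inter.2 ⟨hIS hx.1, mem_sdiff.2 ⟨hI.1 hx.1, hx.2⟩⟩
  · split_ifs with hc
    · exact hI.card_inter_le hτ hc (by rw [card_map, card_polyGraph])
    · exact card_le_card (inter_subset_inter_right hIS)

/-- The plane embedded into the items of a group: the horizontal axis goes to the items that belong
to the group, the rest to the items that all groups share. -/
def groupEmbedding (ι : (ZMod p × ZMod p) ⊕ (Fin G × ZMod p) ↪ Fin m) (g : Fin G) :
    ZMod p × ZMod p ↪ Fin m where
  toFun z := if z.2 = 0 then ι (.inr (g, z.1)) else ι (.inl z)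
  inj' := by
    rintro ⟨x, y⟩ ⟨x', y'⟩ h
    simp only at h
    split_ifs at h with h1 h2 h2 <;> simp_all

/-- The embedding `groupEmbedding`, with relabelled items, that hides the items of the group in the
graph of the polynomial `c`. -/
def hiddenEmbedding (ι : (ZMod p × ZMod p) ⊕ (Fin G × ZMod p) ↪ Fin m) (σ : Equiv.Perm (Fin m))
    (g : Fin G) (c : Fin d → ZMod p) : ZMod p × ZMod p ↪ Fin m :=
  (shear c).symm.toEmbedding.trans ((groupEmbedding ι g).trans σ.toEmbedding)

/-- The items of a group. -/
def groupItems (ι : (ZMod p × ZMod p) ⊕ (Fin G × ZMod p) ↪ Fin m) (σ : Equiv.Perm (Fin m))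
    (g : Fin G) : Finset (Fin m) :=
  univ.image fun x => σ (ι (.inr (g, x)))

/-- The items that all groups share. -/
def sharedItems (ι : (ZMod p × ZMod p) ⊕ (Fin G × ZMod p) ↪ Fin m) (σ : Equiv.Perm (Fin m)) :
    Finset (Fin m) :=
  univ.image fun z => σ (ι (.inl z))

variable (ι : (ZMod p × ZMod p) ⊕ (Fin G × ZMod p) ↪ Fin m) (σ : Equiv.Perm (Fin m))

lemma card_sharedItems_le : (sharedItems ι σ).card ≤ p * p := by
  refine card_image_le.trans ?_
  simp [ZMod.card]

lemma card_groupItems_le (g : Fin G) : (groupItems ι σ g).card ≤ p := by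
  refine card_image_le.trans ?_
  simp [ZMod.card]

lemma disjoint_groupItems {g g' : Fin G} (h : g ≠ g') :
    Disjoint (groupItems ι σ g) (groupItems ι σ g') := by
  rw [disjoint_left]
  intro x hx hx'
  simp only [groupItems, mem_image, mem_univ, true_and] at hx hx'
  obtain ⟨y, rfl⟩ := hx
  obtain ⟨y', hy'⟩ := hx'
  have := ι.injective (σ.injective hy')
  simp only [Sum.inr.injEq, Prod.mk.injEq] at this
  exact h this.1.symm

lemma hiddenEmbedding_apply (g : Fin G) (c : Fin d → ZMod p) (z : ZMod p × ZMod p) :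
    hiddenEmbedding ι σ g c z = if z.2 = polyValue c z.1 then σ (ι (.inr (g, z.1)))
      else σ (ι (.inl (z.1, z.2 - polyValue c z.1))) := by
  change σ (if z.2 - polyValue c z.1 = 0 then ι (.inr (g, z.1))
    else ι (.inl (z.1, z.2 - polyValue c z.1))) = _
  simp only [sub_eq_zero]
  exact apply_ite σ _ _ _

lemma map_polyGraph_hiddenEmbedding (g : Fin G) (c : Fin d → ZMod p) :
    (polyGraph c).map (hiddenEmbedding ι σ g c) = groupItems ι σ g := by
  ext x
  simp only [mem_map, groupItems, mem_image, mem_univ, true_and, mem_polyGraph]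
  constructor
  · rintro ⟨z, hz, rfl⟩
    exact ⟨z.1, by rw [hiddenEmbedding_apply, if_pos hz]⟩
  · rintro ⟨y, rfl⟩
    exact ⟨(y, polyValue c y), rfl, by rw [hiddenEmbedding_apply, if_pos rfl]⟩

lemma map_univ_sdiff_subset_sharedItems (g : Fin G) (c : Fin d → ZMod p) :
    univ.map (hiddenEmbedding ι σ g c) \ (polyGraph c).map (hiddenEmbedding ι σ g c) ⊆
      sharedItems ι σ := by
  intro x hx
  simp only [mem_sdiff, mem_map, mem_univ, true_and, mem_polyGraph] at hx
  obtain ⟨⟨z, rfl⟩, hx⟩ := hx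
  have hz : z.2 ≠ polyValue c z.1 := fun h => hx ⟨z, h, rfl⟩
  rw [hiddenEmbedding_apply, if_neg hz]
  exact mem_image_of_mem _ (mem_univ _)

/-- The polynomials whose graphs have low rank for bidder `ν` of a group: those for which `h` does
not name this bidder. -/
def lowGraphs (h : (Fin d → ZMod p) → Fin N) (ν : Fin N) : Finset (Fin d → ZMod p) :=
  univ.filter fun c => h c ≠ ν

/-- The profile of the hard instance: in each group `g` the polynomial `(x g).1` is the one whose
graph hides the items of the group. -/
def hardProfile (hq : p ≤ 2 * q * τ) (hd : 2 * τ * (d - 1) ≤ q) (κ : Fin G × Fin N ↪ Fin n)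
    (x : Fin G → (Fin d → ZMod p) × ((Fin d → ZMod p) → Fin N)) : Fin n → Valuation m :=
  Function.extend κ
    (fun b S => (graphRank hq hd (hiddenEmbedding ι σ b.1 (x b.1).1)
      (lowGraphs (x b.1).2 b.2) S : ℝ))
    (fun _ _ => 0)

variable (hq : p ≤ 2 * q * τ) (hd : 2 * τ * (d - 1) ≤ q) (κ : Fin G × Fin N ↪ Fin n)
  (x : Fin G → (Fin d → ZMod p) × ((Fin d → ZMod p) → Fin N))

lemma hardProfile_mem (i : Fin n) : IsMatroidRank (hardProfile ι σ hq hd κ x i) := by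
  by_cases h : ∃ b, κ b = i
  · obtain ⟨b, rfl⟩ := h
    rw [hardProfile, κ.injective.extend_apply]
    exact isMatroidRank_graphRank _ _ _ _
  · rw [hardProfile, Function.extend_apply' _ _ _ h]
    exact isMatroidRank_zero

lemma welfare_hardProfile (T : Allocation n m) :
    welfare (hardProfile ι σ hq hd κ x) T =
      ((∑ b : Fin G × Fin N, graphRank hq hd (hiddenEmbedding ι σ b.1 (x b.1).1)
        (lowGraphs (x b.1).2 b.2) (T.bundle (κ b)) : ℕ) : ℝ) := by
  rw [Nat.cast_sum]
  refine (Fintype.sum_of_injective κ κ.injective _ _ ?_ ?_).symm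
  · intro i hi
    rw [hardProfile, Function.extend_apply' _ _ _ (by simpa using hi)]
  · intro b
    rw [hardProfile, κ.injective.extend_apply]

/-- In the hard instance the groups can be given all of their items at full value. -/
lemma exists_allocation_hardProfile :
    ∃ T : Allocation n m, ((G * p : ℕ) : ℝ) ≤ welfare (hardProfile ι σ hq hd κ x) T := by
  let W : Fin G × Fin N → Finset (Fin m) := fun b =>
    if b.2 = (x b.1).2 (x b.1).1 then groupItems ι σ b.1 else ∅
  have hW : ∀ b b', b ≠ b' → Disjoint (W b) (W b') := by
    rintro ⟨g, ν⟩ ⟨g', ν'⟩ h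
    simp only [W]
    split_ifs with h1 h2
    · refine disjoint_groupItems ι σ ?_
      rintro rfl
      exact h (by rw [h1, h2])
    all_goals simp
  let T : Allocation n m := ⟨Function.extend κ W fun _ => ∅, by
    intro i i' hii
    by_cases h : ∃ b, κ b = i
    · obtain ⟨b, rfl⟩ := h
      by_cases h' : ∃ b', κ b' = i'
      · obtain ⟨b', rfl⟩ := h'
        rw [κ.injective.extend_apply, κ.injective.extend_apply]
        exact hW _ _ fun h => hii (by rw [h])
      · rw [Function.extend_apply' _ _ i' h']; simp
    · rw [Function.extend_apply' _ _ i h]; simp⟩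
  refine ⟨T, ?_⟩
  rw [welfare_hardProfile, Nat.cast_le, Fintype.sum_prod_type]
  calc G * p = ∑ _g : Fin G, p := by simp
    _ ≤ _ := sum_le_sum fun g _ => ?_
  refine le_trans (le_of_eq ?_) (single_le_sum (fun _ _ => Nat.zero_le _)
    (mem_univ ((x g).2 (x g).1)))
  have hT : T.bundle (κ (g, (x g).2 (x g).1)) =
      (polyGraph (x g).1).map (hiddenEmbedding ι σ g (x g).1) := by
    rw [map_polyGraph_hiddenEmbedding]
    simp only [T]
    rw [κ.injective.extend_apply]
    simp [W]
  rw [hT, graphRank_eq_of_notMem]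
  simp [lowGraphs]

/-- The welfare in the hard instance, up to the items given to the bidders with full value. -/
lemma welfare_hardProfile_le (hτ : 1 < τ) (T : Allocation n m) :
    welfare (hardProfile ι σ hq hd κ x) T ≤
      ((p * p + G * N * (3 * q) +
        ∑ g, (T.bundle (κ (g, (x g).2 (x g).1)) ∩ groupItems ι σ g).card : ℕ) : ℝ) := by
  rw [welfare_hardProfile, Nat.cast_le]
  have h1 : ∀ b : Fin G × Fin N, graphRank hq hd (hiddenEmbedding ι σ b.1 (x b.1).1)
      (lowGraphs (x b.1).2 b.2) (T.bundle (κ b)) ≤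
        (T.bundle (κ b) ∩ sharedItems ι σ).card + (3 * q +
          if (x b.1).2 (x b.1).1 = b.2 then (T.bundle (κ b) ∩ groupItems ι σ b.1).card
            else 0) := by
    intro b
    refine (graphRank_le hq hd hτ _ _ (x b.1).1 _).trans (Nat.add_le_add (card_le_card
      (inter_subset_inter_left (map_univ_sdiff_subset_sharedItems ι σ b.1 (x b.1).1))) ?_)
    rw [map_polyGraph_hiddenEmbedding]
    by_cases h : (x b.1).2 (x b.1).1 = b.2 <;> simp [lowGraphs, h]
  refine (sum_le_sum fun b _ => h1 b).trans ?_
  rw [sum_add_distrib, sum_add_distrib, ← add_assoc]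
  refine Nat.add_le_add (Nat.add_le_add ?_ ?_) ?_
  -- Bundles are disjoint, so all bidders together get at most `p * p` from the shared items.
  · rw [← card_biUnion]
    · refine (card_le_card ?_).trans (card_sharedItems_le ι σ)
      exact biUnion_subset.2 fun b _ => inter_subset_right
    · intro b _ b' _ h
      exact (T.disjoint _ _ (κ.injective.ne h)).mono inter_subset_left inter_subset_left
  · simp
  · rw [Fintype.sum_prod_type]
    refine sum_le_sum fun g _ => ?_
    simp

lemma sum_bundle_inter_le (T : Allocation n m) (g : Fin G) :
    ∑ ν, (T.bundle (κ (g, ν)) ∩ groupItems ι σ g).card ≤ p := by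
  rw [← card_biUnion]
  · refine (card_le_card ?_).trans (card_groupItems_le ι σ g)
    exact biUnion_subset.2 fun ν _ => inter_subset_right
  · intro ν _ ν' _ h
    exact (T.disjoint _ _ (κ.injective.ne (by simpa using h))).mono inter_subset_left
      inter_subset_left

end HardInstance

/-! ### Averaging over the hard distribution -/

section LowerBound

open Finset

variable {p d τ q G N n m : ℕ} [Fact p.Prime]
  (ι : (ZMod p × ZMod p) ⊕ (Fin G × ZMod p) ↪ Fin m)
  (hq : p ≤ 2 * q * τ) (hd : 2 * τ * (d - 1) ≤ q) (κ : Fin G × Fin N ↪ Fin n)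
  {Ω : Type*} (A : SimultaneousAlgorithm Ω n m)

/-- With short messages, a deterministic algorithm rarely gives the items of a group to the bidder
of the group who has full value for them. -/
lemma sum_bundle_inter_groupItems_le (ω : Ω) {L c : ℕ} (hN : 0 < N)
    (hL : ∀ i v, IsMatroidRank v → (A.message ω i v).length ≤ L)
    (hc : ((L + 1) * 2 ^ L) ^ N * (N + 1) ^ p ^ d ≤ 2 ^ c * N ^ p ^ d) (g : Fin G) :
    (∑ x : Fin G → (Fin d → ZMod p) × ((Fin d → ZMod p) → Fin N), ∑ σ : Equiv.Perm (Fin m),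
      ((A.run ω (hardProfile ι σ hq hd κ x)).bundle (κ (g, (x g).2 (x g).1)) ∩
        groupItems ι σ g).card) * p ^ d ≤
    p * (c + 1) * (Fintype.card (Fin G → (Fin d → ZMod p) × ((Fin d → ZMod p) → Fin N)) *
      Fintype.card (Equiv.Perm (Fin m))) := by
  have : Nonempty (Fin N) := ⟨⟨0, hN⟩⟩
  have hF : Fintype.card (Fin d → ZMod p) = p ^ d := by simp [ZMod.card]
  let π : (ZMod p × ZMod p ↪ Fin m) → ((Fin d → ZMod p) → Fin N) → Fin N → List Bool :=
    fun ψ h ν => A.message ω (κ (g, ν)) (fun S => (graphRank hq hd ψ (lowGraphs h ν) S : ℝ))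
  have hπ : ∀ ψ, (univ.image (π ψ)).card *
      (Fintype.card (Fin N) + 1) ^ Fintype.card (Fin d → ZMod p) ≤
        2 ^ c * Fintype.card (Fin N) ^ Fintype.card (Fin d → ZMod p) := by
    intro ψ
    rw [hF, Fintype.card_fin]
    exact (Nat.mul_le_mul_right _ (card_image_messages_le (π ψ) fun h ν =>
      hL _ _ (isMatroidRank_graphRank _ _ _ _))).trans hc
  choose R hR1 hR2 using fun ψ => exists_guess_bound (π ψ) (hπ ψ)
  rw [hF, Fintype.card_fin] at hR1
  set X : (Fin G → (Fin d → ZMod p) × ((Fin d → ZMod p) → Fin N)) → ℕ :=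
    fun x => ∑ σ : Equiv.Perm (Fin m),
      ((A.run ω (hardProfile ι σ hq hd κ x)).bundle (κ (g, (x g).2 (x g).1)) ∩
        groupItems ι σ g).card with hX
  have hpoint : ∀ x σ f, ∑ h : (Fin d → ZMod p) → Fin N,
      ((A.run ω (hardProfile ι σ hq hd κ (Function.update x g (f, h)))).bundle
        (κ (g, h f)) ∩ groupItems ι σ g).card ≤ p * R (hiddenEmbedding ι σ g f) f := by
    intro x σ f
    -- Only the messages of group `g` depend on the resampled coordinate; all others are frozen, so
    -- the allocation is a function of the group's messages.
    let msg : (Fin N → List Bool) → Fin n → List Bool := fun y => Function.extend κ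
      (fun b => if b.1 = g then y b.2 else A.message ω (κ b) (hardProfile ι σ hq hd κ x (κ b)))
      (fun i => A.message ω i (fun _ => 0))
    have hmsg : ∀ h, (fun i => A.message ω i
        (hardProfile ι σ hq hd κ (Function.update x g (f, h)) i)) =
          msg (π (hiddenEmbedding ι σ g f) h) := by
      intro h
      funext i
      by_cases hi : ∃ b, κ b = i
      · obtain ⟨⟨g', ν⟩, rfl⟩ := hi
        simp only [msg, hardProfile, κ.injective.extend_apply]
        split_ifs with hg
        · subst hg
          simp [π]
        · rw [Function.update_of_ne hg]
      · simp only [msg, hardProfile, Function.extend_apply' _ _ _ hi]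
    refine le_trans (le_of_eq ?_) (hR2 (hiddenEmbedding ι σ g f) f p
      (fun y ν => ((A.allocate ω (msg y)).bundle (κ (g, ν)) ∩ groupItems ι σ g).card)
      fun y => sum_bundle_inter_le ι σ κ _ g)
    refine sum_congr rfl fun h _ => ?_
    rw [← hmsg]
    rfl
  have hB : ∀ x, ∑ a, X (Function.update x g a) ≤
      p * (N ^ p ^ d * (c + 1)) * Fintype.card (Equiv.Perm (Fin m)) := by
    intro x
    calc ∑ a, X (Function.update x g a)
        = ∑ σ : Equiv.Perm (Fin m), ∑ f, ∑ h : (Fin d → ZMod p) → Fin N,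
          ((A.run ω (hardProfile ι σ hq hd κ (Function.update x g (f, h)))).bundle
            (κ (g, h f)) ∩ groupItems ι σ g).card := by
          simp only [hX]
          rw [sum_comm]
          refine sum_congr rfl fun σ _ => ?_
          rw [Fintype.sum_prod_type]
          simp only [Function.update_self]
      _ ≤ ∑ σ : Equiv.Perm (Fin m), ∑ f, p * R (hiddenEmbedding ι σ g f) f :=
          sum_le_sum fun σ _ => sum_le_sum fun f _ => hpoint x σ f
      -- For fixed `f` the shear permutes the plane, so a random `σ` absorbs it: what the group sees
      -- carries no information on `f`, and the sum over `f` can be bounded for one common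
      -- embedding.
      _ = ∑ f, ∑ σ : Equiv.Perm (Fin m),
            p * R ((groupEmbedding ι g).trans σ.toEmbedding) f := by
          rw [sum_comm]
          exact sum_congr rfl fun f _ => sum_perm_embedding (groupEmbedding ι g)
            (shear f).symm (fun ψ => p * R ψ f)
      _ = p * ∑ σ : Equiv.Perm (Fin m), ∑ f,
            R ((groupEmbedding ι g).trans σ.toEmbedding) f := by
          rw [sum_comm, mul_sum]
          exact sum_congr rfl fun σ _ => (mul_sum _ _ _).symm
      _ ≤ p * ∑ _σ : Equiv.Perm (Fin m), N ^ p ^ d * (c + 1) :=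
          Nat.mul_le_mul_left _ (sum_le_sum fun σ _ => hR1 _)
      _ = _ := by rw [sum_const, card_univ, smul_eq_mul]; ring
  have h1 := sum_mul_card_eq_sum_update g X
  have h2 : ∑ x, ∑ a, X (Function.update x g a) ≤ _ := sum_le_sum fun x _ => hB x
  rw [← h1, sum_const, card_univ, smul_eq_mul, Fintype.card_prod, Fintype.card_fun (β := Fin N),
    hF, Fintype.card_fin] at h2
  refine Nat.le_of_mul_le_mul_right (c := N ^ p ^ d) ?_ (by positivity)
  refine le_trans (le_of_eq (by ring)) (h2.trans (le_of_eq (by ring)))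

/-- The average welfare of a deterministic algorithm with short messages on the hard instance. -/
lemma sum_welfare_run_le (ω : Ω) {L c : ℕ} (hN : 0 < N) (hτ : 1 < τ)
    (hL : ∀ i v, IsMatroidRank v → (A.message ω i v).length ≤ L)
    (hc : ((L + 1) * 2 ^ L) ^ N * (N + 1) ^ p ^ d ≤ 2 ^ c * N ^ p ^ d) :
    (∑ x : Fin G → (Fin d → ZMod p) × ((Fin d → ZMod p) → Fin N), ∑ σ : Equiv.Perm (Fin m),
      welfare (hardProfile ι σ hq hd κ x) (A.run ω (hardProfile ι σ hq hd κ x))) * (p : ℝ) ^ d ≤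
    ((p * p + G * N * (3 * q)) * (p : ℝ) ^ d + G * (p * (c + 1))) *
      (Fintype.card (Fin G → (Fin d → ZMod p) × ((Fin d → ZMod p) → Fin N)) *
        Fintype.card (Equiv.Perm (Fin m))) := by
  have h1 : (∑ x : Fin G → (Fin d → ZMod p) × ((Fin d → ZMod p) → Fin N),
      ∑ σ : Equiv.Perm (Fin m),
        (p * p + G * N * (3 * q) + ∑ g, ((A.run ω (hardProfile ι σ hq hd κ x)).bundle
          (κ (g, (x g).2 (x g).1)) ∩ groupItems ι σ g).card)) * p ^ d ≤
      ((p * p + G * N * (3 * q)) * p ^ d + G * (p * (c + 1))) *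
      (Fintype.card (Fin G → (Fin d → ZMod p) × ((Fin d → ZMod p) → Fin N)) *
        Fintype.card (Equiv.Perm (Fin m))) := by
    have h2 := sum_le_sum fun g (_ : g ∈ (univ : Finset (Fin G))) =>
      sum_bundle_inter_groupItems_le ι hq hd κ A ω hN hL hc g
    rw [sum_const, card_univ, Fintype.card_fin, ← sum_mul, sum_comm] at h2
    simp only [sum_add_distrib, sum_const, card_univ, smul_eq_mul]
    rw [add_mul]
    refine le_trans (Nat.add_le_add_left (le_trans (le_of_eq ?_) h2) _) (le_of_eq ?_)
    · congr 1
      exact sum_congr rfl fun x _ => sum_comm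
    · rw [smul_eq_mul]; ring
  refine le_trans (mul_le_mul_of_nonneg_right (sum_le_sum fun x _ => sum_le_sum fun σ _ =>
    welfare_hardProfile_le ι σ hq hd κ x hτ _) (by positivity)) ?_
  exact_mod_cast h1

lemma integrable_welfare_run [MeasurableSpace Ω] (μ : Measure Ω) [IsFiniteMeasure μ]
    {𝒱 : Set (Valuation m)} (hA : A.IsMeasurableOn 𝒱) {v : Fin n → Valuation m}
    (hv : ∀ i, v i ∈ 𝒱) : Integrable (fun ω => welfare v (A.run ω v)) μ := by
  have : Finite (Allocation n m) := Finite.of_injective Allocation.bundle fun _ _ h =>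
    Allocation.ext h
  let _ : MeasurableSpace (Allocation n m) := ⊤
  have hmeas : Measurable fun ω => A.run ω v :=
    measurable_to_countable' fun T => hA v hv T
  obtain ⟨C, hC⟩ := (Set.finite_range fun T : Allocation n m => ‖welfare v T‖).bddAbove
  refine Integrable.of_bound (C := C)
    ((measurable_from_top (f := fun T : Allocation n m => welfare v T)).comp
      hmeas).aestronglyMeasurable ?_
  exact Filter.Eventually.of_forall fun ω => hC ⟨_, rfl⟩

/-- An approximation algorithm with messages of length at most `L` bounds the optimum of the hard
instance. -/
lemma optimum_le_of_approximates (ι : (ZMod p × ZMod p) ⊕ (Fin G × ZMod p) ↪ Fin m)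
    (hq : p ≤ 2 * q * τ) (hd : 2 * τ * (d - 1) ≤ q) (κ : Fin G × Fin N ↪ Fin n) [MeasurableSpace Ω] (μ : Measure Ω) [IsProbabilityMeasure μ]
    {𝒱 : Set (Valuation m)} (h𝒱 : matroidRankValuations m ⊆ 𝒱) (hA : A.IsMeasurableOn 𝒱) {α : ℝ}
    (hα : 0 ≤ α) (happrox : A.Approximates μ 𝒱 α) {L c : ℕ} (hN : 0 < N) (hτ : 1 < τ)
    (hL : ∀ ω i v, IsMatroidRank v → (A.message ω i v).length ≤ L)
    (hc : ((L + 1) * 2 ^ L) ^ N * (N + 1) ^ p ^ d ≤ 2 ^ c * N ^ p ^ d) :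
    (G * p : ℝ) * (p : ℝ) ^ d ≤
      α * ((p * p + G * N * (3 * q)) * (p : ℝ) ^ d + G * (p * (c + 1))) := by
  set K : ℝ := Fintype.card (Fin G → (Fin d → ZMod p) × ((Fin d → ZMod p) → Fin N)) *
    Fintype.card (Equiv.Perm (Fin m)) with hK
  have hNe : Nonempty (Fin N) := ⟨⟨0, hN⟩⟩
  have hKpos : 0 < K := by
    rw [hK]
    exact mul_pos (Nat.cast_pos.2 Fintype.card_pos) (Nat.cast_pos.2 Fintype.card_pos)
  have hp : (0 : ℝ) < (p : ℝ) ^ d := pow_pos (Nat.cast_pos.2 (Fact.out : p.Prime).pos) d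
  set Q : ℝ := (p * p + G * N * (3 * q)) * (p : ℝ) ^ d + G * (p * (c + 1)) with hQ
  have hmem : ∀ x σ i, hardProfile ι σ hq hd κ x i ∈ 𝒱 := fun x σ i =>
    h𝒱 (hardProfile_mem ι σ hq hd κ x i)
  have hint : ∀ x σ, Integrable (fun ω => welfare (hardProfile ι σ hq hd κ x)
      (A.run ω (hardProfile ι σ hq hd κ x))) μ := fun x σ =>
    integrable_welfare_run A μ hA (hmem x σ)
  have h1 : K * (G * p : ℝ) ≤ α * ∫ ω, ∑ x, ∑ σ, welfare (hardProfile ι σ hq hd κ x)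
      (A.run ω (hardProfile ι σ hq hd κ x)) ∂μ := by
    rw [integral_finsetSum _ fun x _ => integrable_finsetSum _ fun σ _ => hint x σ, mul_sum]
    have h2 : K * (G * p : ℝ) =
        ∑ _x : Fin G → (Fin d → ZMod p) × ((Fin d → ZMod p) → Fin N),
          ∑ _σ : Equiv.Perm (Fin m), (G * p : ℝ) := by
      simp only [sum_const, card_univ, nsmul_eq_mul, hK]
      ring
    rw [h2]
    refine sum_le_sum fun x _ => ?_
    rw [integral_finsetSum _ fun σ _ => hint x σ, mul_sum]
    refine sum_le_sum fun σ _ => ?_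
    obtain ⟨T, hT⟩ := exists_allocation_hardProfile ι σ hq hd κ x
    rw [Nat.cast_mul] at hT
    exact hT.trans (happrox _ (hmem x σ) T)
  have h3 : ∫ ω, ∑ x, ∑ σ, welfare (hardProfile ι σ hq hd κ x)
      (A.run ω (hardProfile ι σ hq hd κ x)) ∂μ ≤ Q * K / (p : ℝ) ^ d := by
    have h4 := integral_mono (μ := μ) (integrable_finsetSum univ fun x _ =>
      integrable_finsetSum univ fun σ _ => hint x σ) (integrable_const (Q * K / (p : ℝ) ^ d))
      fun ω => (le_div_iff₀ hp).2
        (sum_welfare_run_le ι hq hd κ A ω hN hτ (hL ω) hc)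
    simpa using h4
  have h5 := h1.trans (mul_le_mul_of_nonneg_left h3 hα)
  rw [← mul_div_assoc, le_div_iff₀ hp] at h5
  refine le_of_mul_le_mul_left (le_trans (le_of_eq ?_) (h5.trans (le_of_eq ?_))) hKpos <;> ring

end LowerBound

/-! ### Choice of parameters and estimates -/

section Parameters

/-- This is `(1 + 1 / N) ^ t ≤ exp (t / N)` with `exp 1 ≤ 4` and the exponent rounded up. -/
lemma succ_pow_le_four_pow_mul {N : ℕ} (hN : 0 < N) (t : ℕ) :
    (N + 1) ^ t ≤ 4 ^ (t / N + 1) * N ^ t := by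
  have hN' : (0 : ℝ) < N := Nat.cast_pos.2 hN
  have h1 : ((1 : ℝ) / N + 1) ^ t ≤ 4 ^ (t / N + 1) := by
    calc ((1 : ℝ) / N + 1) ^ t ≤ Real.exp (1 / N) ^ t :=
          pow_le_pow_left₀ (by positivity) (Real.add_one_le_exp _) _
      _ = Real.exp (t / N) := by rw [← Real.exp_nat_mul]; congr 1; ring
      _ ≤ Real.exp (((t / N + 1 : ℕ) : ℝ) * 1) := by
          refine Real.exp_le_exp.2 ?_
          rw [mul_one, div_le_iff₀ hN']
          have := (Nat.lt_div_mul_add (a := t) hN).le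
          have h : t ≤ (t / N + 1) * N := by rw [add_mul, one_mul]; exact this
          exact_mod_cast h
      _ = Real.exp 1 ^ (t / N + 1) := Real.exp_nat_mul _ _
      _ ≤ 4 ^ (t / N + 1) := pow_le_pow_left₀ (Real.exp_pos _).le
          (by have := Real.exp_one_lt_d9; linarith) _
  have h2 : ((N : ℝ) + 1) ^ t ≤ 4 ^ (t / N + 1) * (N : ℝ) ^ t := by
    calc ((N : ℝ) + 1) ^ t = ((1 : ℝ) / N + 1) ^ t * (N : ℝ) ^ t := by
          rw [← mul_pow]; congr 1; field_simp; ring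
      _ ≤ _ := mul_le_mul_of_nonneg_right h1 (by positivity)
  exact_mod_cast h2

lemma message_count_le {N : ℕ} (hN : 0 < N) (L t : ℕ) :
    ((L + 1) * 2 ^ L) ^ N * (N + 1) ^ t ≤ 2 ^ (2 * L * N + 2 * (t / N + 1)) * N ^ t := by
  have h1 : (L + 1) * 2 ^ L ≤ 2 ^ (2 * L) := by
    rw [two_mul, pow_add]
    exact Nat.mul_le_mul_right _ (Nat.lt_two_pow_self (n := L))
  calc ((L + 1) * 2 ^ L) ^ N * (N + 1) ^ t
      ≤ (2 ^ (2 * L)) ^ N * (4 ^ (t / N + 1) * N ^ t) :=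
        Nat.mul_le_mul (Nat.pow_le_pow_left h1 N) (succ_pow_le_four_pow_mul hN t)
    _ = _ := by rw [show (4 : ℕ) = 2 ^ 2 by norm_num, ← pow_mul, ← pow_mul, pow_add, ← mul_assoc]

/-- Blind guessing accounts for `2 * p ^ (s + 1)`. The message length and the rounding add at most
`7 * 2 ^ s * s ^ 6`, which `p ^ (s + 1) ≥ s ^ 14 * 2 ^ s` absorbs. -/
lemma exponent_mul_le {s p L : ℕ} (hs : 2 ≤ s) (hp : s ^ 14 ≤ p) (hL : L ≤ 2 ^ (s + 1)) :
    (2 * L * s ^ 3 + 2 * (p ^ (s + 1) / s ^ 3 + 1) + 1) * s ^ 3 ≤ 3 * p ^ (s + 1) := by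
  have h1 : p ^ (s + 1) / s ^ 3 * s ^ 3 ≤ p ^ (s + 1) := Nat.div_mul_le_self _ _
  have h2 : s ^ 14 * 2 ^ s ≤ p ^ (s + 1) := by
    rw [pow_succ p, mul_comm]
    refine Nat.mul_le_mul (Nat.pow_le_pow_left (le_trans ?_ hp) s) hp
    exact hs.trans (Nat.le_self_pow (by norm_num) s)
  have h3 : 2 * L * s ^ 6 ≤ 4 * 2 ^ s * s ^ 6 := by
    rw [pow_succ] at hL
    exact Nat.mul_le_mul_right _ (by omega)
  have h4 : 3 * s ^ 3 ≤ 3 * (2 ^ s * s ^ 6) := by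
    refine Nat.mul_le_mul_left _ ?_
    calc s ^ 3 ≤ s ^ 6 := Nat.pow_le_pow_right (by omega) (by norm_num)
      _ ≤ 2 ^ s * s ^ 6 := Nat.le_mul_of_pos_left _ (by positivity)
  have h5 : 7 * (2 ^ s * s ^ 6) ≤ s ^ 14 * 2 ^ s := by
    have h6 : 7 ≤ s ^ 8 := le_trans (by norm_num) (Nat.pow_le_pow_left hs 8)
    calc 7 * (2 ^ s * s ^ 6) ≤ s ^ 8 * (2 ^ s * s ^ 6) := Nat.mul_le_mul_right _ h6
      _ = _ := by ring
  have h7 : (2 * L * s ^ 3 + 2 * (p ^ (s + 1) / s ^ 3 + 1) + 1) * s ^ 3 =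
    2 * L * s ^ 6 + 2 * (p ^ (s + 1) / s ^ 3 * s ^ 3) + 3 * s ^ 3 := by ring
  rw [h7]
  linarith

/-- The hard instance contradicts the approximation factor `4 * s ^ 2`. -/
lemma approximation_contradiction {s p c t α : ℝ} (hs : 45 ≤ s) (hp : s ^ 14 ≤ p)
    (hp' : p ≤ 2 * s ^ 14) (ht : 0 < t) (hα : α ≤ 4 * s ^ 2) (hc0 : 0 ≤ c)
    (hc : (c + 1) * s ^ 3 ≤ 3 * t)
    (h : (s ^ 17 * p) * t ≤
      α * ((p * p + s ^ 17 * s ^ 3 * (3 * (2 * s ^ 8))) * t + s ^ 17 * (p * (c + 1)))) :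
    False := by
  have hs0 : 0 < s := by linarith
  have hp0 : 0 < p := lt_of_lt_of_le (by positivity) hp
  have h1 : s ^ 17 * (p * (c + 1)) ≤ s ^ 14 * p * (3 * t) := by
    calc s ^ 17 * (p * (c + 1)) = s ^ 14 * p * ((c + 1) * s ^ 3) := by ring
      _ ≤ _ := mul_le_mul_of_nonneg_left hc (by positivity)
  have h2 : p * p ≤ 2 * s ^ 14 * p := mul_le_mul_of_nonneg_right hp' hp0.le
  have h3 : s ^ 17 * s ^ 3 * (3 * (2 * s ^ 8)) ≤ 6 * s ^ 14 * p := by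
    calc s ^ 17 * s ^ 3 * (3 * (2 * s ^ 8)) = 6 * s ^ 14 * s ^ 14 := by ring
      _ ≤ _ := mul_le_mul_of_nonneg_left hp (by positivity)
  -- Shared items, low-rank graphs and correct guesses contribute 2, 6 and 3, hence the factor 11.
  have h4 : (p * p + s ^ 17 * s ^ 3 * (3 * (2 * s ^ 8))) * t + s ^ 17 * (p * (c + 1)) ≤
      11 * s ^ 14 * p * t := by
    have := mul_le_mul_of_nonneg_right (add_le_add h2 h3) ht.le
    linarith
  have h5 : (s ^ 17 * p) * t ≤ 4 * s ^ 2 * (11 * s ^ 14 * p * t) :=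
    h.trans (mul_le_mul hα h4 (by positivity) (by positivity))
  -- Here `44 = 4 * 11`, which is why `s` starts at 45.
  have h6 : s * (s ^ 16 * p * t) ≤ 44 * (s ^ 16 * p * t) :=
    le_trans (le_of_eq (by ring)) (h5.trans (le_of_eq (by ring)))
  have := le_of_mul_le_mul_right h6 (by positivity)
  linarith

lemma exists_root (b e : ℕ) (he : e ≠ 0) {m : ℕ} (hm : b ^ e ≤ m) :
    ∃ s : ℕ, b ≤ s ∧ s ^ e ≤ m ∧ m < (s + 1) ^ e := by
  have hex : ∃ r : ℕ, m < (r + 1) ^ e :=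
    ⟨m, (Nat.lt_succ_self m).trans_le (Nat.le_self_pow he _)⟩
  have hle : b ≤ Nat.find hex := (Nat.le_find_iff hex b).2 fun r hr =>
    not_lt.2 ((Nat.pow_le_pow_left (Nat.succ_le_of_lt hr) e).trans hm)
  refine ⟨Nat.find hex, hle, ?_, Nat.find_spec hex⟩
  rcases Nat.eq_zero_or_pos (Nat.find hex) with h0 | h0
  · rw [h0, zero_pow he]; exact Nat.zero_le m
  · have h := Nat.find_min hex (m := Nat.find hex - 1) (by omega)
    rw [Nat.sub_add_cancel h0] at h
    exact not_lt.1 h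

lemma pow_rpow_of_mul_eq {x : ℝ} (hx : 0 ≤ x) {a b : ℕ} {y : ℝ} (h : a * y = b) :
    (x ^ a) ^ y = x ^ b := by
  rw [← Real.rpow_natCast, ← Real.rpow_natCast, ← Real.rpow_mul hx, h]

lemma rpow_bounds {m s : ℕ} (hm : s ^ 32 ≤ m) (hm' : m < (s + 1) ^ 32) :
    (m : ℝ) ^ (1 / 32 : ℝ) ≤ s + 1 ∧ (m : ℝ) ^ (1 / 16 : ℝ) ≤ (s + 1) ^ 2 ∧
      (s : ℝ) ^ 8 ≤ (m : ℝ) ^ (1 / 4 : ℝ) := by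
  have hu : (m : ℝ) ≤ ((s : ℝ) + 1) ^ 32 := by
    have := Nat.cast_le (α := ℝ).2 hm'.le
    rwa [Nat.cast_pow, Nat.cast_succ] at this
  have hl : (s : ℝ) ^ 32 ≤ m := by
    have := Nat.cast_le (α := ℝ).2 hm
    rwa [Nat.cast_pow] at this
  have hm0 : (0 : ℝ) ≤ m := Nat.cast_nonneg m
  have hs0 : (0 : ℝ) ≤ s := Nat.cast_nonneg s
  have hs1 : (0 : ℝ) ≤ (s : ℝ) + 1 := by linarith
  refine ⟨?_, ?_, ?_⟩
  · rw [← pow_one ((s : ℝ) + 1), ← pow_rpow_of_mul_eq (a := 32) (y := 1 / 32) hs1 (by norm_num)]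
    exact Real.rpow_le_rpow hm0 hu (by norm_num)
  · rw [← pow_rpow_of_mul_eq (a := 32) (y := 1 / 16) hs1 (by norm_num)]
    exact Real.rpow_le_rpow hm0 hu (by norm_num)
  · rw [← pow_rpow_of_mul_eq (a := 32) (y := 1 / 4) hs0 (by norm_num)]
    exact Real.rpow_le_rpow (pow_nonneg hs0 32) hl (by norm_num)

/-- With `y = m ^ (1 / 4)`, the bracket is at least `y ^ 3 / 2 ≥ s ^ 24 / 2`; of the factor `m ^ (1
/ 8)` only that it is at least 1 matters. -/
lemma pow_le_bidders {m n s : ℕ} (hs : 2 ≤ s) (hm : s ^ 32 ≤ m)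
    (hs8 : (s : ℝ) ^ 8 ≤ (m : ℝ) ^ (1 / 4 : ℝ))
    (hn : (m : ℝ) ^ (1 / 8 : ℝ) * ((m : ℝ) ^ (3 / 4 : ℝ) - (m : ℝ) ^ (1 / 2 : ℝ) + 1) ≤ (n : ℝ)) :
    s ^ 20 ≤ n := by
  have h34 : (m : ℝ) ^ (3 / 4 : ℝ) = ((m : ℝ) ^ (1 / 4 : ℝ)) ^ 3 := by
    rw [← Real.rpow_natCast, ← Real.rpow_mul (by positivity)]; norm_num
  have h12 : (m : ℝ) ^ (1 / 2 : ℝ) = ((m : ℝ) ^ (1 / 4 : ℝ)) ^ 2 := by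
    rw [← Real.rpow_natCast, ← Real.rpow_mul (by positivity)]; norm_num
  have h18 : (1 : ℝ) ≤ (m : ℝ) ^ (1 / 8 : ℝ) := by
    refine Real.one_le_rpow ?_ (by norm_num)
    exact Nat.one_le_cast.2 (le_trans (Nat.one_le_pow 32 s (by omega)) hm)
  rw [h34, h12] at hn
  set y := (m : ℝ) ^ (1 / 4 : ℝ)
  have hs' : (2 : ℝ) ≤ s := by exact_mod_cast hs
  have h16 : (2 : ℝ) ^ 8 ≤ (s : ℝ) ^ 8 := pow_le_pow_left₀ (by norm_num) hs' 8
  have h4 : (2 : ℝ) ^ 4 ≤ (s : ℝ) ^ 4 := pow_le_pow_left₀ (by norm_num) hs' 4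
  have hy : (256 : ℝ) ≤ y := by norm_num at h16; linarith
  have h1 : y ^ 3 / 2 ≤ y ^ 3 - y ^ 2 + 1 := by
    have : y ^ 2 * 2 ≤ y ^ 2 * y := mul_le_mul_of_nonneg_left (by linarith) (by positivity)
    nlinarith
  have h2 : ((s : ℝ) ^ 8) ^ 3 ≤ y ^ 3 := pow_le_pow_left₀ (by positivity) hs8 3
  have h3 : (s : ℝ) ^ 20 * 2 ≤ ((s : ℝ) ^ 8) ^ 3 := by
    rw [← pow_mul, show 8 * 3 = 20 + 4 by norm_num, pow_add]
    exact mul_le_mul_of_nonneg_left (by linarith) (by positivity)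
  have h5 : y ^ 3 - y ^ 2 + 1 ≤
      (m : ℝ) ^ (1 / 8 : ℝ) * (y ^ 3 - y ^ 2 + 1) :=
    le_mul_of_one_le_left (le_trans (by positivity) h1) h18
  have h6 : (s : ℝ) ^ 20 ≤ n := by linarith
  exact_mod_cast h6

lemma items_card_le {m s p : ℕ} (hs : 3 ≤ s) (hm : s ^ 32 ≤ m) (hp : p ≤ 2 * s ^ 14) :
    p * p + s ^ 17 * p ≤ m := by
  refine le_trans ?_ hm
  have h1 : p * p ≤ 2 * s ^ 14 * (2 * s ^ 14) := Nat.mul_le_mul hp hp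
  have h2 : s ^ 17 * p ≤ s ^ 17 * (2 * s ^ 14) := Nat.mul_le_mul_left _ hp
  have h3 : 4 ≤ s ^ 3 := le_trans (by norm_num) (Nat.pow_le_pow_left hs 3)
  have h4 : 4 * s ^ 28 ≤ s ^ 3 * s ^ 28 := Nat.mul_le_mul_right _ h3
  have h5 : 3 * s ^ 31 ≤ s * s ^ 31 := Nat.mul_le_mul_right _ hs
  have e1 : 2 * s ^ 14 * (2 * s ^ 14) = 4 * s ^ 28 := by ring
  have e2 : s ^ 17 * (2 * s ^ 14) = 2 * s ^ 31 := by ring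
  have e3 : s ^ 3 * s ^ 28 = s ^ 31 := by ring
  have e4 : s * s ^ 31 = s ^ 32 := by ring
  omega

end Parameters

end SimAuction

end

theorem mainTheorem6 :
    ∃ m₀ : ℕ, ∀ m n : ℕ, m₀ ≤ m →
      (m : ℝ) ^ (1 / 8 : ℝ) * ((m : ℝ) ^ (3 / 4 : ℝ) - (m : ℝ) ^ (1 / 2 : ℝ) + 1) ≤ (n : ℝ) →
      ∀ 𝒱 : Set (SimAuction.Valuation m),
        (𝒱 = SimAuction.matroidRankValuations m ∨
          𝒱 = SimAuction.grossSubstitutesValuations m) →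
        ∀ (Ω : Type*) [MeasurableSpace Ω] (μ : MeasureTheory.Measure Ω)
          [MeasureTheory.IsProbabilityMeasure μ]
          (A : SimAuction.SimultaneousAlgorithm Ω n m),
          A.IsMeasurableOn 𝒱 →
          A.Approximates μ 𝒱 ((m : ℝ) ^ (1 / 16 : ℝ)) →
          ∃ (ω : Ω) (v : Fin n → SimAuction.Valuation m), (∀ i, v i ∈ 𝒱) ∧
            (2 : ℝ) ^ ((m : ℝ) ^ (1 / 32 : ℝ)) < (A.bits ω v : ℝ) := by
  obtain ⟨m₀, hm₀_eq⟩ : ∃ m₀ : ℕ, m₀ = 45 ^ 32 := ⟨_, rfl⟩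
  refine ⟨m₀, fun m n hm₀ hn 𝒱 h𝒱 Ω _ μ _ A hA happrox => ?_⟩
  by_contra! hbits
  have hsub : SimAuction.matroidRankValuations m ⊆ 𝒱 := by
    rcases h𝒱 with rfl | rfl
    · exact subset_rfl
    · exact SimAuction.matroidRankValuations_subset m
  -- `s` is the integer part of `m ^ (1 / 32)`. The parameters are `d = s + 1`, `τ = s ^ 7`, `q = 2
  -- * s ^ 8`, `G = s ^ 17`, `N = s ^ 3`, and a Bertrand prime `p` between `s ^ 14` and `2 * s ^
  -- 14`.
  obtain ⟨s, hs, hm, hm'⟩ := SimAuction.exists_root 45 32 (by norm_num) (hm₀_eq ▸ hm₀)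
  obtain ⟨hr1, hr2, hr3⟩ := SimAuction.rpow_bounds hm hm'
  obtain ⟨p, hpp, hp, hp'⟩ := Nat.exists_prime_lt_and_le_two_mul (s ^ 14) (by positivity)
  have : Fact p.Prime := ⟨hpp⟩
  have hq : p ≤ 2 * (2 * s ^ 8) * s ^ 7 := by
    refine hp'.trans ?_
    calc 2 * s ^ 14 ≤ 4 * s * s ^ 14 := Nat.mul_le_mul_right _ (by omega)
      _ = _ := by ring
  have hd : 2 * s ^ 7 * (s + 1 - 1) ≤ 2 * s ^ 8 := le_of_eq (by rw [Nat.add_sub_cancel]; ring)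
  obtain ⟨ι⟩ : Nonempty ((ZMod p × ZMod p) ⊕ (Fin (s ^ 17) × ZMod p) ↪ Fin m) :=
    Function.Embedding.nonempty_of_card_le (by
      simpa [ZMod.card] using SimAuction.items_card_le (by omega) hm hp')
  obtain ⟨κ⟩ : Nonempty (Fin (s ^ 17) × Fin (s ^ 3) ↪ Fin n) :=
    Function.Embedding.nonempty_of_card_le (by
      have := SimAuction.pow_le_bidders (by omega) hm hr3 hn
      simpa [← pow_add] using this)
  let L : ℕ := ⌊(2 : ℝ) ^ ((m : ℝ) ^ (1 / 32 : ℝ))⌋₊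
  have hL : L ≤ 2 ^ (s + 1) := by
    refine Nat.floor_le_of_le ?_
    have h := Real.rpow_le_rpow_of_exponent_le (x := 2) (by norm_num) hr1
    refine h.trans (le_of_eq ?_)
    rw [← Nat.cast_succ, Real.rpow_natCast]
    push_cast
    rfl
  have hlen : ∀ ω i v, SimAuction.IsMatroidRank v → (A.message ω i v).length ≤ L := by
    intro ω i v hv
    -- The bound on total communication, applied to the profile where everybody has valuation `v`,
    -- bounds each single message.
    refine le_trans ?_ (Nat.le_floor (hbits ω (fun _ => v) fun _ => hsub hv))
    exact Finset.single_le_sum (f := fun i => (A.message ω i v).length)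
      (fun _ _ => Nat.zero_le _) (Finset.mem_univ i)
  have hN : 0 < s ^ 3 := Nat.pow_pos (by omega)
  have hτ : 1 < s ^ 7 := Nat.one_lt_pow (by norm_num) (by omega)
  have hmain := SimAuction.optimum_le_of_approximates A ι hq hd κ μ hsub hA
    (Real.rpow_nonneg (Nat.cast_nonneg m) _) happrox hN hτ hlen
    (SimAuction.message_count_le hN L (p ^ (s + 1)))
  have hs' : (45 : ℝ) ≤ s := by exact_mod_cast hs
  refine SimAuction.approximation_contradiction (s := s) (p := p) (t := (p : ℝ) ^ (s + 1))
    (c := (2 * L * s ^ 3 + 2 * (p ^ (s + 1) / s ^ 3 + 1) : ℕ)) hs' (by exact_mod_cast hp.le)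
    (by exact_mod_cast hp') (pow_pos (by exact_mod_cast hpp.pos) _) ?_ (Nat.cast_nonneg _)
    (by exact_mod_cast SimAuction.exponent_mul_le (by omega) hp.le hL)
    (by push_cast at hmain ⊢; exact hmain)
  calc (m : ℝ) ^ (1 / 16 : ℝ) ≤ ((s : ℝ) + 1) ^ 2 := hr2
    _ ≤ (2 * (s : ℝ)) ^ 2 := pow_le_pow_left₀ (by positivity) (by linarith only [hs']) 2
    _ = 4 * (s : ℝ) ^ 2 := by ring
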